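/- Consider a discrete-time LLM serving system with KV cache capacity $M$ and $m$ request classes. A request of class $k\in\{1,\dots,m\}$ has a known prompt length $l^{(k)}\in\mathbb N$ and a known output length $o^{(k)}\ge 1$. The number of class-$k$ requests arriving in a slot has law $\mathbb P_k$, with mean $\lambda_k$ and finite second moment; for each $k$ these numbers are i.i.d. over the slots. The system starts empty. Let $b_k$ be integers with $b_k>\lambda_k$ for every $k$. In each slot, the flow-controlled policy adds the new arrivals to the waiting queue. Then, for every $k$, it moves waiting class-$k$ requests to the active set in first-in-first-out order, until $b_k$ of them have been activated in this slot or none is left waiting. Then every active request generates one output token, and the requests that have generated all of their output tokens are removed at the end of the slot. The KV cache usage in a slot is the sum of (prompt length $+$ number of tokens generated by the end of the slot) over the requests that are active in the slot, including those completed in it. Suppose that $$\sum_{k=1}^m b_k\Bigl(l^{(k)}o^{(k)}+\tfrac12\bigl(o^{(k)}+(o^{(k)})^2\bigr)\Bigr)<M .$$ Then: (i) in every slot at most $b_k$ requests of each class $k$ are activated, and the KV cache usage never exceeds $M$; (ii) the system is stable: for each class $k$, the number of waiting class-$k$ requests at the end of a slot is a positive recurrent Markov chain (the states it reaches with positive probability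 communicate and have finite mean return times), and the total number of unfinished requests (waiting or active) does not explode, i.e. it is bounded in probability uniformly in time: for every $\varepsilon>0$ there is a $C$ such that in every slot it exceeds $C$ with probability at most $\varepsilon$. -/

import Mathlib

open MeasureTheory ProbabilityTheory
open scoped ENNReal

namespace LLMServing

/-! ### The serving system and the flow-controlled policy -/

/-- A request: prompt length, output length (both in tokens) and arrival slot. -/
structure Request where
  prompt : ℕ
  output : ℕ
  arrival : ℕ

/-- An activated request together with the number of output tokens it has generated so far. -/
structure ActiveRequest where
  req : Request
  generated : ℕ

/-- KV cache occupied by an active request: its prompt plus the tokens generated so far. -/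
def ActiveRequest.usage (p : ActiveRequest) : ℕ := p.req.prompt + p.generated

/-- The request generates one more output token. -/
def ActiveRequest.decode (p : ActiveRequest) : ActiveRequest :=
  { p with generated := p.generated + 1 }

/-- State of the system between two slots: the waiting queue, sorted by class and, inside each
class, by order of arrival (oldest first), and the active set. -/
structure State (m : ℕ) where
  waiting : Fin m → List Request
  active : List ActiveRequest

/-- The empty system. -/
def State.empty (m : ℕ) : State m := ⟨fun _ => [], []⟩

section Policy

variable {m : ℕ} (l o b : Fin m → ℕ)

/-- The waiting requests of class `k` in slot `t` once the `n k` new class-`k` arrivals of the slot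
have joined the end of the queue. -/
def queued (s : State m) (t : ℕ) (n : Fin m → ℕ) (k : Fin m) : List Request :=
  s.waiting k ++ List.replicate (n k) ⟨l k, o k, t⟩

/-- The class-`k` requests activated in slot `t`: first in, first out, until `b k` have been
activated or no class-`k` request is waiting any more. -/
def activated (s : State m) (t : ℕ) (n : Fin m → ℕ) (k : Fin m) : List Request :=
  (queued l o s t n k).take (b k)

/-- The active set of slot `t` (old and newly activated requests) after every one of its requests
has generated one token, and before the completed ones are removed. -/
def processed (s : State m) (t : ℕ) (n : Fin m → ℕ) : List ActiveRequest :=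
  (s.active ++ ((List.finRange m).flatMap (activated l o b s t n)).map
    (fun r => ActiveRequest.mk r 0)).map ActiveRequest.decode

/-- One slot of the flow-controlled policy. -/
def step (s : State m) (t : ℕ) (n : Fin m → ℕ) : State m where
  waiting k := (queued l o s t n k).drop (b k)
  active := (processed l o b s t n).filter (fun p => p.generated < p.req.output)

/-- The state at the beginning of slot `t`, if `n s k` requests of class `k` arrive in slot `s`
and the system starts empty. -/
def run (n : ℕ → Fin m → ℕ) : ℕ → State m
  | 0 => State.empty m
  | t + 1 => step l o b (run n t) t (n t)

/-- Number of class-`k` requests activated in slot `t`. -/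
def numActivated (n : ℕ → Fin m → ℕ) (t : ℕ) (k : Fin m) : ℕ :=
  (activated l o b (run l o b n t) t (n t) k).length

/-- KV cache usage in slot `t`; requests that complete in the slot still count. -/
def kvUsage (n : ℕ → Fin m → ℕ) (t : ℕ) : ℕ :=
  ((processed l o b (run l o b n t) t (n t)).map ActiveRequest.usage).sum

/-- Number of class-`k` requests that wait after the first `t` slots. -/
def queueLength (n : ℕ → Fin m → ℕ) (k : Fin m) (t : ℕ) : ℕ :=
  ((run l o b n t).waiting k).length

/-- Number of requests, waiting or active, that are in the system after the first `t` slots. -/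
def unfinished (n : ℕ → Fin m → ℕ) (t : ℕ) : ℕ :=
  (∑ k, queueLength l o b n k t) + (run l o b n t).active.length

end Policy

/-! ### Positive recurrence and stability -/

section Chains

variable {Ω : Type*} [MeasurableSpace Ω] {S : Type*}

/-- `X` is a time-homogeneous Markov chain with transition probabilities `p`. -/
def IsMarkovChain (μ : Measure Ω) (p : S → PMF S) (X : ℕ → Ω → S) : Prop :=
  ∀ (t : ℕ) (x : ℕ → S),
    μ {ω | ∀ i ≤ t + 1, X i ω = x i} = μ {ω | ∀ i ≤ t, X i ω = x i} * p (x t) (x (t + 1))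

/-- The time that passes after time `s` until the next visit to `y`, `∞` if there is none. -/
noncomputable def returnTime (X : ℕ → Ω → S) (y : S) (s : ℕ) (ω : Ω) : ℝ≥0∞ :=
  ⨅ (t : ℕ) (_ : 1 ≤ t ∧ X (s + t) ω = y), (t : ℝ≥0∞)

/-- `X` is a positive recurrent Markov chain: it is Markov, the states which it visits with positive
probability communicate, and each of them has finite mean return time. (The integral over
`{X s = y}` is the mean return time given `X s = y`, times the probability of `X s = y`.) -/
def IsPositiveRecurrent (μ : Measure Ω) (X : ℕ → Ω → S) : Prop :=
  (∃ p : S → PMF S, IsMarkovChain μ p X) ∧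
  (∀ (s s' : ℕ) (x y : S), 0 < μ {ω | X s ω = x} → 0 < μ {ω | X s' ω = y} →
    ∃ t, 0 < μ {ω | X s ω = x ∧ X (s + t) ω = y}) ∧
  (∀ (s : ℕ) (y : S), ∫⁻ ω in {ω | X s ω = y}, returnTime X y s ω ∂μ < ∞)

/-- The random numbers `Z 0, Z 1, …` are bounded in probability: they do not explode over time. -/
def BoundedInProbability (μ : Measure Ω) (Z : ℕ → Ω → ℕ) : Prop :=
  ∀ ε : ℝ≥0∞, 0 < ε → ∃ C : ℕ, ∀ t, μ {ω | C < Z t ω} ≤ ε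

/-- The system under the flow-controlled policy, fed by the random arrival counts `N`, is stable:
the waiting queue of each class is positive recurrent, and the total number of unfinished requests
does not explode. -/
def IsStable {m : ℕ} (μ : Measure Ω) (l o b : Fin m → ℕ) (N : ℕ → Fin m → Ω → ℕ) : Prop :=
  (∀ k, IsPositiveRecurrent μ (fun t ω => queueLength l o b (fun s j => N s j ω) k t)) ∧
  BoundedInProbability μ (fun t ω => unfinished l o b (fun s j => N s j ω) t)

end Chains

end LLMServing

namespace LLMServing

/-! ### Pathwise bounds on the active set and the KV cache -/

section PolicyBounds

variable {m : ℕ} (l o b : Fin m → ℕ)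

/-! A request stays active for exactly as many slots as it has output tokens, and at most `b k` of
class `k` start per slot. So in every slot at most `b k` of them have any given age `j`, with `1 ≤ j
≤ o k` after decoding, and the usage is at most the sum of `b k * (l k + j)`. This is the left side
of the capacity condition (`weight_active_le`, `kvUsage_le`).

Each waiting queue is a Lindley recursion with service `b k`. Started empty, its mean grows in time
(`integral_lindley_mono`), while the second moment has drift at most `σ - 2 (c - lam) E t`. Summing
the drift over the slots from `t` to `2t` keeps the mean bounded (`exists_integral_lindley_le`), and
Markov's inequality gives tightness.

By tightness the queue is below some `C` with probability at least one half. From there it can empty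
and retrace a path to `y`, so the probability of being at `y` is eventually bounded below by some `a
> 0`. Decomposing by the last visit to `y` then bounds the mean return time by `1 / a`
(`tsum_avoid_ne_top`). -/

theorem length_activated_le (s : State m) (t : ℕ) (n : Fin m → ℕ) (k : Fin m) :
    (activated l o b s t n k).length ≤ b k :=
  List.length_take_le _ _

theorem waiting_eq_class (n : ℕ → Fin m → ℕ) (t : ℕ) (k : Fin m) :
    ∀ r ∈ (run l o b n t).waiting k, r.prompt = l k ∧ r.output = o k := by
  induction t with
  | zero => intro r hr; simp [run, State.empty] at hr
  | succ t ih =>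
    intro r hr
    have hr' := List.mem_of_mem_drop hr
    rcases List.mem_append.1 hr' with h | h
    · exact ih r h
    · rw [List.eq_of_mem_replicate h]
      exact ⟨rfl, rfl⟩

theorem activated_eq_class (n : ℕ → Fin m → ℕ) (t : ℕ) (k : Fin m) :
    ∀ r ∈ activated l o b (run l o b n t) t (n t) k, r.prompt = l k ∧ r.output = o k := by
  intro r hr
  rcases List.mem_append.1 (List.mem_of_mem_take hr) with h | h
  · exact waiting_eq_class l o b n t k r h
  · rw [List.eq_of_mem_replicate h]
    exact ⟨rfl, rfl⟩

/-- Total weight of a list of active requests, if a request weighs `g prompt output generated`. -/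
def weight (g : ℕ → ℕ → ℕ → ℕ) (L : List ActiveRequest) : ℕ :=
  (L.map fun p => g p.req.prompt p.req.output p.generated).sum

/-- Removal of completed requests is absorbed into the weight, just as decoding becomes a shift of
its last argument in `weight_processed`. Hence the bounds below are proved for all `g` at once. -/
theorem weight_filter (g : ℕ → ℕ → ℕ → ℕ) (L : List ActiveRequest) :
    weight g (L.filter fun p => p.generated < p.req.output) =
      weight (fun x y z => if z < y then g x y z else 0) L := by
  induction L with
  | nil => rfl
  | cons p L ih =>
    simp only [weight] at ih ⊢
    by_cases h : p.generated < p.req.output <;> simp [h, ih]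

/-- The requests activated in slot `t` weigh at most as much as full budgets of new requests. -/
theorem weight_activated_le (g : ℕ → ℕ → ℕ → ℕ) (n : ℕ → Fin m → ℕ) (t : ℕ) :
    weight g (((List.finRange m).flatMap (activated l o b (run l o b n t) t (n t))).map
      fun r => ActiveRequest.mk r 0) ≤ ∑ k, b k * g (l k) (o k) 0 := by
  have h : ∀ k, (((activated l o b (run l o b n t) t (n t) k).map
      fun r => g r.prompt r.output 0).sum) ≤ b k * g (l k) (o k) 0 := by
    intro k
    have h1 : (activated l o b (run l o b n t) t (n t) k).map (fun r => g r.prompt r.output 0) =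
        (activated l o b (run l o b n t) t (n t) k).map (fun _ => g (l k) (o k) 0) :=
      List.map_congr_left fun r hr => by
        rw [(activated_eq_class l o b n t k r hr).1, (activated_eq_class l o b n t k r hr).2]
    rw [h1, List.map_const', List.sum_replicate, smul_eq_mul]
    exact Nat.mul_le_mul_right _ (length_activated_le l o b _ t _ k)
  have h2 : ∀ L : List (Fin m), weight g ((L.flatMap
      (activated l o b (run l o b n t) t (n t))).map fun r => ActiveRequest.mk r 0) ≤
      (L.map fun k => b k * g (l k) (o k) 0).sum := by
    intro L
    induction L with
    | nil => simp [weight]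
    | cons k L ih =>
      have hk := h k
      simp only [weight, List.map_map] at ih ⊢
      simp only [List.flatMap_cons, List.map_append, List.sum_append, List.map_cons,
        List.sum_cons]
      exact Nat.add_le_add hk ih
  refine (h2 _).trans (le_of_eq ?_)
  rw [← List.ofFn_eq_map, List.sum_ofFn]

theorem weight_processed (g : ℕ → ℕ → ℕ → ℕ) (s : State m) (t : ℕ) (n : Fin m → ℕ) :
    weight g (processed l o b s t n) = weight (fun x y z => g x y (z + 1)) s.active +
      weight (fun x y z => g x y (z + 1)) (((List.finRange m).flatMap (activated l o b s t n)).map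
        fun r => ActiveRequest.mk r 0) := by
  simp only [weight, processed, List.map_append, List.sum_append, List.map_map]
  rfl

theorem weight_processed_le (g : ℕ → ℕ → ℕ → ℕ) (n : ℕ → Fin m → ℕ) (t : ℕ)
    (ho : ∀ k, 1 ≤ o k)
    (h : ∀ g : ℕ → ℕ → ℕ → ℕ, weight g (run l o b n t).active ≤
      ∑ k, b k * ∑ j ∈ Finset.Ico 1 (o k), g (l k) (o k) j) :
    weight g (processed l o b (run l o b n t) t (n t)) ≤
      ∑ k, b k * ∑ j ∈ Finset.Ico 1 (o k + 1), g (l k) (o k) j := by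
  rw [weight_processed]
  refine (add_le_add (h _) (weight_activated_le l o b _ n t)).trans (le_of_eq ?_)
  rw [← Finset.sum_add_distrib]
  refine Finset.sum_congr rfl fun k _ => ?_
  -- New requests supply the term of age `1`; the old ages `1, …, o k - 1` move up to `2, …, o k`.
  rw [← mul_add, Finset.sum_eq_sum_Ico_succ_bot (Nat.lt_succ_of_le (ho k)),
    ← Finset.sum_Ico_add' (fun j => g (l k) (o k) j) 1 (o k) 1, add_comm]

/-- Letting `g` vary bounds the number of requests of each age without labelling them by class. The
induction needs this generality, because one slot replaces `g` by a shifted and truncated weight. -/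
theorem weight_active_le (g : ℕ → ℕ → ℕ → ℕ) (n : ℕ → Fin m → ℕ) (t : ℕ) (ho : ∀ k, 1 ≤ o k) :
    weight g (run l o b n t).active ≤
      ∑ k, b k * ∑ j ∈ Finset.Ico 1 (o k), g (l k) (o k) j := by
  induction t generalizing g with
  | zero => simp [run, State.empty, weight]
  | succ t ih =>
    change weight g (List.filter _ (processed l o b (run l o b n t) t (n t))) ≤ _
    rw [weight_filter]
    refine (weight_processed_le l o b _ n t ho ih).trans (le_of_eq ?_)
    refine Finset.sum_congr rfl fun k _ => ?_
    -- Requests of age `o k` have just completed, so their truncated weight vanishes.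
    rw [Finset.sum_Ico_succ_top (ho k)]
    simp only [lt_irrefl, if_false, add_zero]
    congr 1
    exact Finset.sum_congr rfl fun j hj => if_pos (Finset.mem_Ico.1 hj).2

theorem length_active_le (n : ℕ → Fin m → ℕ) (t : ℕ) (ho : ∀ k, 1 ≤ o k) :
    (run l o b n t).active.length ≤ ∑ k, b k * (o k - 1) := by
  simpa [weight] using weight_active_le l o b (fun _ _ _ => 1) n t ho

theorem kvUsage_le (n : ℕ → Fin m → ℕ) (t : ℕ) (ho : ∀ k, 1 ≤ o k) :
    (kvUsage l o b n t : ℝ) ≤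
      ∑ k, (b k : ℝ) * ((l k : ℝ) * o k + ((o k : ℝ) + (o k : ℝ) ^ 2) / 2) := by
  have h : kvUsage l o b n t ≤ ∑ k, b k * ∑ j ∈ Finset.Ico 1 (o k + 1), (l k + j) :=
    weight_processed_le l o b (fun x _ z => x + z) n t ho
      fun g => weight_active_le l o b g n t ho
  refine (Nat.cast_le.2 h).trans (le_of_eq ?_)
  push_cast
  refine Finset.sum_congr rfl fun k _ => ?_
  congr 1
  have hs : ∀ c : ℕ, ∑ j ∈ Finset.Ico 1 (c + 1), ((l k : ℝ) + j) =
      (l k : ℝ) * c + ((c : ℝ) + (c : ℝ) ^ 2) / 2 := by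
    intro c
    induction c with
    | zero => simp
    | succ c ih =>
      rw [Finset.sum_Ico_succ_top (by omega), ih]
      push_cast
      ring
  exact hs _

end PolicyBounds

/-! ### The queue of one class -/

/-- The queue length after `t` slots, if it starts from `x`, `n s` customers arrive in slot `s`, and
up to `c` customers are served in each slot. -/
def lindley (c : ℕ) (n : ℕ → ℕ) (x : ℕ) : ℕ → ℕ
  | 0 => x
  | t + 1 => lindley c n x t + n t - c

theorem queueLength_eq_lindley {m : ℕ} (l o b : Fin m → ℕ) (n : ℕ → Fin m → ℕ) (k : Fin m)
    (t : ℕ) : queueLength l o b n k t = lindley (b k) (fun s => n s k) 0 t := by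
  induction t with
  | zero => rfl
  | succ t ih =>
    have h : queueLength l o b n k (t + 1) = queueLength l o b n k t + n t k - b k := by
      simp [queueLength, run, step, queued]
    rw [h, ih, lindley]

section Lindley

variable {c : ℕ} {n n' : ℕ → ℕ} {x y : ℕ}

theorem lindley_congr {t : ℕ} (h : ∀ i < t, n i = n' i) : lindley c n x t = lindley c n' x t := by
  induction t with
  | zero => rfl
  | succ t ih => rw [lindley, lindley, ih fun i hi => h i (by omega), h t (by omega)]

theorem lindley_add (s t : ℕ) :
    lindley c n x (s + t) = lindley c (fun j => n (s + j)) (lindley c n x s) t := by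
  induction t with
  | zero => rfl
  | succ t ih => rw [← add_assoc, lindley, lindley, ih]

theorem lindley_mono (h : x ≤ y) (t : ℕ) : lindley c n x t ≤ lindley c n y t := by
  induction t with
  | zero => exact h
  | succ t ih => rw [lindley, lindley]; omega

/-- Each slot with fewer than `c` arrivals lowers a nonempty queue by at least one. -/
theorem lindley_le_sub {t : ℕ} (h : ∀ i < t, n i < c) : lindley c n x t ≤ x - t := by
  induction t with
  | zero => exact le_rfl
  | succ t ih =>
    have h1 := ih fun i hi => h i (by omega)
    have h2 := h t (by omega)
    rw [lindley]
    omega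

theorem measurable_lindley (t : ℕ) : Measurable fun n : ℕ → ℕ => lindley c n x t := by
  induction t with
  | zero => exact measurable_const
  | succ t ih => exact (ih.add (measurable_pi_apply t)).sub measurable_const

end Lindley

/-! ### Independence and shift invariance of the arrivals -/

section IID

variable {Ω : Type*} [MeasurableSpace Ω] {μ : Measure Ω} {ξ : ℕ → Ω → ℕ} {ν : Measure ℕ}

theorem indepFun_past_future (hm : ∀ t, Measurable (ξ t)) (hi : iIndepFun ξ μ) (s : ℕ) :
    IndepFun (fun ω (i : Fin s) => ξ i ω) (fun ω (j : ℕ) => ξ (s + j) ω) μ := by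
  have hd : Disjoint (Set.Iio s) (Set.Ici s) :=
    Set.disjoint_left.2 fun i h1 h2 => absurd (Set.mem_Iio.1 h1) (not_lt.2 h2)
  have h := indep_iSup_of_disjoint (fun i => (hm i).comap_le) hi hd
  refine indep_of_indep_of_le_right (indep_of_indep_of_le_left h ?_) ?_
  · simp only [MeasurableSpace.pi, MeasurableSpace.comap_iSup, MeasurableSpace.comap_comp]
    exact iSup_le fun i => le_iSup₂_of_le (i : ℕ) i.2 le_rfl
  · simp only [MeasurableSpace.pi, MeasurableSpace.comap_iSup, MeasurableSpace.comap_comp]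
    exact iSup_le fun j => le_iSup₂_of_le (s + j) (Nat.le_add_right s j) le_rfl

/-- Both laws are the infinite product of copies of `ν`. -/
theorem map_shift_eq (hm : ∀ t, Measurable (ξ t)) (hi : iIndepFun ξ μ)
    (hd : ∀ t, μ.map (ξ t) = ν) (s : ℕ) :
    μ.map (fun ω (j : ℕ) => ξ (s + j) ω) = μ.map (fun ω j => ξ j ω) := by
  rw [hi.map_fun_eq_infinitePi_map hm,
    (hi.precomp (g := fun j => s + j) fun _ _ h => Nat.add_left_cancel h).map_fun_eq_infinitePi_map
      fun j => hm (s + j)]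
  simp only [hd]

theorem measure_shift (hm : ∀ t, Measurable (ξ t)) (hi : iIndepFun ξ μ)
    (hd : ∀ t, μ.map (ξ t) = ν) (s : ℕ) {B : Set (ℕ → ℕ)} (hB : MeasurableSet B) :
    μ {ω | (fun j => ξ (s + j) ω) ∈ B} = μ {ω | (fun j => ξ j ω) ∈ B} := by
  have h := congrArg (fun m => m B) (map_shift_eq hm hi hd s)
  rwa [Measure.map_apply (measurable_pi_lambda _ fun j => hm _) hB,
    Measure.map_apply (measurable_pi_lambda _ fun j => hm _) hB] at h

/-- An event that depends on the first `s` variables is independent of one about the later variables,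
and the latter may be shifted back to time `0`. -/
theorem measure_inter_shift (hm : ∀ t, Measurable (ξ t)) (hi : iIndepFun ξ μ)
    (hd : ∀ t, μ.map (ξ t) = ν) (s : ℕ) {A B : Set (ℕ → ℕ)}
    (hA : ∀ n n' : ℕ → ℕ, (∀ i < s, n i = n' i) → n ∈ A → n' ∈ A) (hB : MeasurableSet B) :
    μ {ω | (fun j => ξ j ω) ∈ A ∧ (fun j => ξ (s + j) ω) ∈ B} =
      μ {ω | (fun j => ξ j ω) ∈ A} * μ {ω | (fun j => ξ j ω) ∈ B} := by
  -- The padding by `0` is harmless, since `A` sees only the first `s` coordinates. On the countable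
  -- space `Fin s → ℕ` the preimage of `A` is automatically measurable.
  let e : (Fin s → ℕ) → ℕ → ℕ := fun v i => if h : i < s then v ⟨i, h⟩ else 0
  have hpre : {ω | (fun j => ξ j ω) ∈ A} = (fun ω (i : Fin s) => ξ i ω) ⁻¹' (e ⁻¹' A) := by
    ext ω
    constructor
    · exact hA _ _ fun i hi => by simp [e, hi]
    · exact hA _ _ fun i hi => by simp [e, hi]
  have h := (indepFun_past_future hm hi s).measure_inter_preimage_eq_mul (e ⁻¹' A) B
    (.of_discrete) hB
  rw [← hpre] at h
  rw [← measure_shift hm hi hd s hB]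
  exact h

theorem measurable_lindley_comp (hm : ∀ t, Measurable (ξ t)) (c x t : ℕ) :
    Measurable fun ω => lindley c (fun j => ξ j ω) x t :=
  (measurable_lindley t).comp (measurable_pi_lambda _ hm)

theorem indepFun_lindley (hm : ∀ t, Measurable (ξ t)) (hi : iIndepFun ξ μ) (c x t : ℕ) :
    IndepFun (fun ω => lindley c (fun j => ξ j ω) x t) (ξ t) μ := by
  let e : (Fin t → ℕ) → ℕ → ℕ := fun v i => if h : i < t then v ⟨i, h⟩ else 0
  have h0 : Measurable fun n : ℕ → ℕ => n 0 := measurable_pi_apply 0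
  have h := (indepFun_past_future hm hi t).comp
    (.of_discrete : Measurable fun v : Fin t → ℕ => lindley c (e v) x t) h0
  convert h using 1
  · funext ω
    exact lindley_congr fun i hi => by simp [e, hi]
  · rfl

/-! ### Tightness -/

theorem memLp_lindley [IsProbabilityMeasure μ] (hm : ∀ t, Measurable (ξ t))
    (h2 : ∀ t, MemLp (fun ω => (ξ t ω : ℝ)) 2 μ) (c t : ℕ) :
    MemLp (fun ω => (lindley c (fun j => ξ j ω) 0 t : ℝ)) 2 μ := by
  induction t with
  | zero => simp [lindley]
  | succ t ih =>
    refine (ih.add (h2 t)).of_le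
      (measurable_from_top.comp (measurable_lindley_comp hm c 0 (t + 1))).aestronglyMeasurable
      (Filter.Eventually.of_forall fun ω => ?_)
    simp only [Pi.add_apply]
    rw [Real.norm_of_nonneg (by positivity), Real.norm_of_nonneg (by positivity)]
    exact_mod_cast Nat.sub_le _ _

/-- Drop the first slot: the queue at `t + 1` is one run for `t` slots on shifted arrivals from a
nonnegative start. It dominates the queue started from `0` on those arrivals, which has the law of
the original queue at `t`. -/
theorem integral_lindley_mono [IsProbabilityMeasure μ] (hm : ∀ t, Measurable (ξ t))
    (hi : iIndepFun ξ μ) (hd : ∀ t, μ.map (ξ t) = ν)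
    (h2 : ∀ t, MemLp (fun ω => (ξ t ω : ℝ)) 2 μ) (c : ℕ) :
    Monotone fun t => ∫ ω, (lindley c (fun j => ξ j ω) 0 t : ℝ) ∂μ := by
  refine monotone_nat_of_le_succ fun t => ?_
  have hf : Measurable fun n : ℕ → ℕ => (lindley c n 0 t : ℝ) :=
    measurable_from_top.comp (measurable_lindley t)
  have h1 : ∫ ω, (lindley c (fun j => ξ j ω) 0 t : ℝ) ∂μ =
      ∫ ω, (lindley c (fun j => ξ (1 + j) ω) 0 t : ℝ) ∂μ := by
    rw [← integral_map (φ := fun ω j => ξ j ω) (measurable_pi_lambda _ hm).aemeasurable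
        hf.aestronglyMeasurable,
      ← integral_map (φ := fun ω j => ξ (1 + j) ω)
        (measurable_pi_lambda _ fun j => hm _).aemeasurable hf.aestronglyMeasurable,
      map_shift_eq hm hi hd 1]
  rw [h1]
  refine integral_mono_of_nonneg (Filter.Eventually.of_forall fun ω => by positivity)
    ((memLp_lindley hm h2 c (t + 1)).integrable (by norm_num))
    (Filter.Eventually.of_forall fun ω => ?_)
  simp only [Nat.cast_le]
  rw [add_comm t 1, lindley_add]
  exact lindley_mono (Nat.zero_le _) t

/-- Truncation at `0` only decreases the square of `x + ξ t - c`, and independence of the queue from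
`ξ t` factors the cross term. -/
theorem integral_sq_lindley_succ_le [IsProbabilityMeasure μ] (hm : ∀ t, Measurable (ξ t))
    (hi : iIndepFun ξ μ) (h2 : ∀ t, MemLp (fun ω => (ξ t ω : ℝ)) 2 μ) (c t : ℕ) :
    ∫ ω, (lindley c (fun j => ξ j ω) 0 (t + 1) : ℝ) ^ 2 ∂μ ≤
      ∫ ω, (lindley c (fun j => ξ j ω) 0 t : ℝ) ^ 2 ∂μ +
        2 * ((∫ ω, (lindley c (fun j => ξ j ω) 0 t : ℝ) ∂μ) * ∫ ω, ((ξ t ω : ℝ) - c) ∂μ) +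
        ∫ ω, ((ξ t ω : ℝ) - c) ^ 2 ∂μ := by
  have hX := memLp_lindley hm h2 c t
  have hY : MemLp (fun ω => (ξ t ω : ℝ) - c) 2 μ := (h2 t).sub (memLp_const _)
  have hXY : IndepFun (fun ω => (lindley c (fun j => ξ j ω) 0 t : ℝ))
      (fun ω => (ξ t ω : ℝ) - c) μ :=
    (indepFun_lindley hm hi c 0 t).comp (φ := fun n : ℕ => (n : ℝ))
      (ψ := fun n : ℕ => (n : ℝ) - c) .of_discrete .of_discrete
  have hi2 : Integrable (fun ω => (lindley c (fun j => ξ j ω) 0 t : ℝ) * ((ξ t ω : ℝ) - c)) μ :=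
    hX.integrable_mul hY
  rw [← hXY.integral_fun_mul_eq_mul_integral hX.1 hY.1, ← integral_const_mul,
    ← integral_add hX.integrable_sq (hi2.const_mul 2),
    ← integral_add (μ := μ) (f := fun ω => (lindley c (fun j => ξ j ω) 0 t : ℝ) ^ 2 +
        2 * ((lindley c (fun j => ξ j ω) 0 t : ℝ) * ((ξ t ω : ℝ) - c)))
      (hX.integrable_sq.add (hi2.const_mul 2)) hY.integrable_sq]
  refine integral_mono (memLp_lindley hm h2 c (t + 1)).integrable_sq
    ((hX.integrable_sq.add (hi2.const_mul 2)).add hY.integrable_sq) fun ω => ?_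
  simp only [lindley]
  generalize lindley c (fun j => ξ j ω) 0 t = x
  rcases le_total c (x + ξ t ω) with h | h
  · rw [Nat.cast_sub h]
    push_cast
    nlinarith
  · rw [Nat.sub_eq_zero_of_le h]
    push_cast
    nlinarith [sq_nonneg ((x : ℝ) + (ξ t ω - c))]

/-- If fewer than `c` customers arrive per slot on average, then the mean queue length is bounded
over time. -/
theorem exists_integral_lindley_le [IsProbabilityMeasure μ] (hm : ∀ t, Measurable (ξ t))
    (hi : iIndepFun ξ μ) (hd : ∀ t, μ.map (ξ t) = ν) (h2 : MemLp (fun n : ℕ => (n : ℝ)) 2 ν)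
    {c : ℕ} (hc : ∫ n : ℕ, (n : ℝ) ∂ν < c) :
    ∃ B : ℝ, ∀ t, ∫ ω, (lindley c (fun j => ξ j ω) 0 t : ℝ) ∂μ ≤ B := by
  have h2' : ∀ t, MemLp (fun ω => (ξ t ω : ℝ)) 2 μ := fun t =>
    (hd t ▸ h2 : MemLp (fun n : ℕ => (n : ℝ)) 2 (μ.map (ξ t))).comp_of_map (hm t).aemeasurable
  have hmap : ∀ (f : ℕ → ℝ) t, ∫ ω, f (ξ t ω) ∂μ = ∫ n, f n ∂ν := fun f t => by
    rw [← hd t, integral_map (hm t).aemeasurable Measurable.of_discrete.aestronglyMeasurable]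
  set lam := ∫ n : ℕ, (n : ℝ) ∂ν
  set σ := ∫ n : ℕ, ((n : ℝ) - c) ^ 2 ∂ν with hσ
  set E : ℕ → ℝ := fun t => ∫ ω, (lindley c (fun j => ξ j ω) 0 t : ℝ) ∂μ with hE
  set Q : ℕ → ℝ := fun t => ∫ ω, (lindley c (fun j => ξ j ω) 0 t : ℝ) ^ 2 ∂μ with hQ
  have hmono : Monotone E := integral_lindley_mono hm hi hd h2' c
  have hE0 : ∀ t, 0 ≤ E t := fun t => integral_nonneg fun ω => by positivity
  have hQ0 : ∀ t, 0 ≤ Q t := fun t => integral_nonneg fun ω => by positivity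
  have hstep : ∀ t, Q (t + 1) ≤ Q t - 2 * (c - lam) * E t + σ := fun t => by
    have h := integral_sq_lindley_succ_le hm hi h2' c t
    rw [hmap (fun n => ((n : ℝ) - c) ^ 2) t, integral_sub ((h2' t).integrable (by norm_num))
      (integrable_const _), hmap (fun n => (n : ℝ)) t] at h
    simp only [integral_const, probReal_univ, one_smul] at h
    change Q (t + 1) ≤ Q t + 2 * (E t * (lam - c)) + σ at h
    linarith
  -- Monotonicity replaces every later mean by `E s`.
  have hsum : ∀ s t, Q (s + t) ≤ Q s - t * (2 * (c - lam) * E s) + t * σ := by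
    intro s t
    induction t with
    | zero => simp
    | succ t ih =>
      have h1 := hstep (s + t)
      have h3 : 2 * (c - lam) * E s ≤ 2 * (c - lam) * E (s + t) :=
        mul_le_mul_of_nonneg_left (hmono (Nat.le_add_right s t)) (by linarith)
      rw [← add_assoc]
      push_cast
      linarith
  have hσ0 : 0 ≤ σ := integral_nonneg fun n => sq_nonneg _
  have hQle : ∀ t : ℕ, Q t ≤ t * σ := by
    intro t
    have h1 := hsum 0 t
    have h3 : Q 0 = 0 := by simp [hQ, lindley]
    have h4 : 0 ≤ (t : ℝ) * (2 * (c - lam) * E 0) :=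
      mul_nonneg (Nat.cast_nonneg t) (mul_nonneg (by linarith) (hE0 0))
    rw [zero_add] at h1
    linarith
  refine ⟨σ / (c - lam), fun t => ?_⟩
  rw [le_div_iff₀ (by linarith)]
  rcases Nat.eq_zero_or_pos t with rfl | ht
  · simpa [lindley] using hσ0
  -- Over the slots from `t` to `2t`: `0 ≤ Q (2t) ≤ Q t - 2t (c - lam) E t + tσ`, with `Q t ≤ tσ`.
  -- Dividing by `2t` gives the bound.
  · have h1 := hsum t t
    have h3 := hQle t
    have h4 := hQ0 (t + t)
    have ht' : (0 : ℝ) < t := Nat.cast_pos.2 ht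
    change E t * (c - lam) ≤ σ
    nlinarith

theorem exists_lintegral_lindley_le [IsProbabilityMeasure μ] (hm : ∀ t, Measurable (ξ t))
    (hi : iIndepFun ξ μ) (hd : ∀ t, μ.map (ξ t) = ν) (h2 : MemLp (fun n : ℕ => (n : ℝ)) 2 ν)
    {c : ℕ} (hc : ∫ n : ℕ, (n : ℝ) ∂ν < c) :
    ∃ B : ℝ≥0∞, B ≠ ∞ ∧ ∀ t, ∫⁻ ω, (lindley c (fun j => ξ j ω) 0 t : ℝ≥0∞) ∂μ ≤ B := by
  obtain ⟨B, hB⟩ := exists_integral_lindley_le hm hi hd h2 hc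
  have h2' : ∀ t, MemLp (fun ω => (ξ t ω : ℝ)) 2 μ := fun t =>
    (hd t ▸ h2 : MemLp (fun n : ℕ => (n : ℝ)) 2 (μ.map (ξ t))).comp_of_map (hm t).aemeasurable
  refine ⟨ENNReal.ofReal B, ENNReal.ofReal_ne_top, fun t => ?_⟩
  refine le_trans (le_of_eq ?_) (ENNReal.ofReal_le_ofReal (hB t))
  rw [ofReal_integral_eq_lintegral_ofReal
    ((memLp_lindley hm h2' c t).integrable (by norm_num))
    (Filter.Eventually.of_forall fun ω => by positivity)]
  simp

theorem boundedInProbability_of_lintegral_le {Z : ℕ → Ω → ℕ} (hZ : ∀ t, Measurable (Z t))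
    {B : ℝ≥0∞} (hB : B ≠ ∞) (h : ∀ t, ∫⁻ ω, (Z t ω : ℝ≥0∞) ∂μ ≤ B) :
    BoundedInProbability μ Z := by
  intro ε hε
  obtain ⟨C, hC⟩ := ENNReal.exists_nat_gt (ENNReal.div_ne_top hB hε.ne')
  refine ⟨C, fun t => ?_⟩
  rcases eq_or_ne ε ∞ with rfl | hε'
  · exact le_top
  have hC0 : (C : ℝ≥0∞) ≠ 0 := (lt_of_le_of_lt zero_le hC).ne'
  have h1 : (C : ℝ≥0∞) * μ {ω | C < Z t ω} ≤ B := by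
    refine le_trans ?_ ((mul_meas_ge_le_lintegral (μ := μ)
      (Measurable.of_discrete.comp (hZ t) : Measurable fun ω => (Z t ω : ℝ≥0∞)) C).trans (h t))
    refine mul_le_mul_right (measure_mono fun ω hω => ?_) _
    exact (Nat.cast_le (α := ℝ≥0∞)).2 (le_of_lt hω)
  have h3 : B ≤ C * ε := (ENNReal.div_le_iff hε.ne' hε').1 hC.le
  exact (ENNReal.mul_le_mul_iff_right hC0 (ENNReal.natCast_ne_top C)).1 (h1.trans h3)

end IID

/-! ### Markov property, communication and visit probabilities -/

section Recurrence

variable {Ω : Type*} [MeasurableSpace Ω] {μ : Measure Ω} {ξ : ℕ → Ω → ℕ} {ν : Measure ℕ}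

theorem isMarkovChain_lindley [IsProbabilityMeasure μ] (hm : ∀ t, Measurable (ξ t))
    (hi : iIndepFun ξ μ) (hd : ∀ t, μ.map (ξ t) = ν) (c : ℕ) :
    ∃ p : ℕ → PMF ℕ, IsMarkovChain μ p fun t ω => lindley c (fun j => ξ j ω) 0 t := by
  have hpm : ∀ x : ℕ, Measurable fun ω => x + ξ 0 ω - c := fun x =>
    (measurable_const.add (hm 0)).sub measurable_const
  have hprob : ∀ x : ℕ, IsProbabilityMeasure (μ.map fun ω => x + ξ 0 ω - c) := fun x =>
    Measure.isProbabilityMeasure_map (hpm x).aemeasurable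
  refine ⟨fun x => (μ.map fun ω => x + ξ 0 ω - c).toPMF, fun t x => ?_⟩
  have h := measure_inter_shift hm hi hd t (A := {n | ∀ i ≤ t, lindley c n 0 i = x i})
    (B := {n : ℕ → ℕ | x t + n 0 - c = x (t + 1)})
    (fun n n' hn hA i hit => by
      rw [← hA i hit]
      exact (lindley_congr fun j hj => hn j (by omega)).symm)
    (measurableSet_eq_fun (by fun_prop) measurable_const)
  rw [Measure.toPMF_apply, Measure.map_apply (hpm _) (measurableSet_singleton _)]
  refine Eq.trans (congrArg μ (Set.ext fun ω => ?_)) h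
  simp only [Set.mem_ofPred_eq, add_zero]
  constructor
  · intro hω
    refine ⟨fun i hit => hω i (by omega), ?_⟩
    rw [← hω (t + 1) le_rfl, ← hω t (by omega), lindley]
  · rintro ⟨h1, h3⟩ i hit
    rcases Nat.lt_or_eq_of_le hit with h4 | rfl
    · exact h1 i (by omega)
    · rw [← h3, ← h1 t le_rfl, lindley]

theorem measure_lindley_inter [IsProbabilityMeasure μ] (hm : ∀ t, Measurable (ξ t))
    (hi : iIndepFun ξ μ) (hd : ∀ t, μ.map (ξ t) = ν) (c s : ℕ) {A : Set ℕ} {B : Set (ℕ → ℕ)}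
    (hB : MeasurableSet B) :
    μ {ω | lindley c (fun j => ξ j ω) 0 s ∈ A ∧ (fun j => ξ (s + j) ω) ∈ B} =
      μ {ω | lindley c (fun j => ξ j ω) 0 s ∈ A} * μ {ω | (fun j => ξ j ω) ∈ B} :=
  measure_inter_shift hm hi hd s (A := {n | lindley c n 0 s ∈ A})
    (fun n n' hn hA => by
      have h := lindley_congr (c := c) (x := 0) hn
      simpa only [Set.mem_ofPred_eq, ← h] using hA) hB

/-- With positive probability, every slot of a time interval has less arrivals than services. -/
theorem measure_forall_lt_pos (hm : ∀ t, Measurable (ξ t))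
    (hi : iIndepFun ξ μ) (hd : ∀ t, μ.map (ξ t) = ν) {c : ℕ} (hc : 0 < ν (Set.Iio c)) (t : ℕ) :
    0 < μ {ω | ∀ i < t, ξ i ω < c} := by
  have h := hi.meas_biInter (S := Finset.range t) (s := fun i => ξ i ⁻¹' Set.Iio c)
    fun i _ => ⟨Set.Iio c, measurableSet_Iio, rfl⟩
  have h1 : (⋂ i ∈ Finset.range t, ξ i ⁻¹' Set.Iio c) = {ω | ∀ i < t, ξ i ω < c} := by
    ext ω
    simp
  rw [h1] at h
  rw [h]
  refine (pos_iff_ne_zero).2 (Finset.prod_ne_zero_iff.2 fun i _ => ?_)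
  rw [← Measure.map_apply (hm i) measurableSet_Iio, hd i]
  exact hc.ne'

theorem measure_Iio_pos_of_integral_lt [IsProbabilityMeasure ν]
    (h2 : Integrable (fun n : ℕ => (n : ℝ)) ν) {c : ℕ} (hc : ∫ n : ℕ, (n : ℝ) ∂ν < c) :
    0 < ν (Set.Iio c) := by
  by_contra h
  have h0 : ν (Set.Iio c) = 0 := by simpa using h
  have h1 : ∀ᵐ n : ℕ ∂ν, (c : ℝ) ≤ n := by
    refine measure_mono_null (fun (n : ℕ) hn => ?_) h0
    simpa using hn
  have h3 := integral_mono_ae (integrable_const (c : ℝ)) h2 h1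
  simp at h3
  linarith

theorem measurableSet_forall_lt (c t : ℕ) : MeasurableSet {n : ℕ → ℕ | ∀ i < t, n i < c} := by
  have h : {n : ℕ → ℕ | ∀ i < t, n i < c} = ⋂ i, ⋂ (_ : i < t), {n : ℕ → ℕ | n i < c} := by
    ext n
    simp
  rw [h]
  exact MeasurableSet.iInter fun i => MeasurableSet.iInter fun _ =>
    measurableSet_lt (measurable_pi_apply i) measurable_const

theorem measurableSet_lindley_eq (c x t y : ℕ) : MeasurableSet {n : ℕ → ℕ | lindley c n x t = y} :=
  measurableSet_eq_fun (measurable_lindley t) measurable_const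

/-- From a set of states below `C`, the queue empties within `C` slots and then repeats a given
path from `0` to `y`. -/
theorem mul_le_measure_lindley_eq [IsProbabilityMeasure μ] (hm : ∀ t, Measurable (ξ t))
    (hi : iIndepFun ξ μ) (hd : ∀ t, μ.map (ξ t) = ν) {c C : ℕ} {A : Set ℕ} (hA : ∀ x ∈ A, x ≤ C)
    (s t y : ℕ) :
    μ {ω | lindley c (fun j => ξ j ω) 0 s ∈ A} *
        (μ {ω | ∀ i < C, ξ i ω < c} * μ {ω | lindley c (fun j => ξ j ω) 0 t = y}) ≤
      μ {ω | lindley c (fun j => ξ j ω) 0 s ∈ A ∧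
        lindley c (fun j => ξ j ω) 0 (s + (C + t)) = y} := by
  have h1 := measure_inter_shift hm hi hd C (A := {n | ∀ i < C, n i < c})
    (B := {n : ℕ → ℕ | lindley c n 0 t = y})
    (fun n n' hn hA i hiC => by rw [← hn i hiC]; exact hA i hiC)
    (measurableSet_lindley_eq c 0 t y)
  have hshift : Measurable fun (n : ℕ → ℕ) (j : ℕ) => n (C + j) :=
    measurable_pi_lambda _ fun j => measurable_pi_apply _
  have h3 := measure_lindley_inter hm hi hd c s (A := A)
    (B := {n | ∀ i < C, n i < c} ∩ (fun (n : ℕ → ℕ) (j : ℕ) => n (C + j)) ⁻¹'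
      {n : ℕ → ℕ | lindley c n 0 t = y})
    ((measurableSet_forall_lt c C).inter (hshift (measurableSet_lindley_eq c 0 t y)))
  refine (le_of_eq ((congrArg _ h1.symm).trans h3.symm)).trans (measure_mono ?_)
  rintro ω ⟨hωA, hω1, hω2⟩
  refine ⟨hωA, ?_⟩
  simp only [Set.mem_preimage, Set.mem_ofPred_eq] at hω1 hω2
  rw [lindley_add, lindley_add]
  -- A queue of at most `C` is empty after `C` slots of fewer than `c` arrivals.
  have h0 : lindley c (fun j => ξ (s + j) ω) (lindley c (fun j => ξ j ω) 0 s) C = 0 :=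
    Nat.le_zero.1 ((lindley_le_sub hω1).trans (by have := hA _ hωA; omega))
  rw [h0]
  exact hω2

/-! ### Mean return times -/

/-- Tail-sum formula: the `j`-th indicator says that the return takes more than `j` slots. If there
is no return, all indicators are `1` and the sum is infinite. -/
theorem returnTime_le_tsum {Ω : Type*} {S : Type*} (X : ℕ → Ω → S) (y : S) (s : ℕ) (ω : Ω) :
    returnTime X y s ω ≤
      ∑' j : ℕ, Set.indicator {ω | ∀ i ∈ Set.Icc 1 j, X (s + i) ω ≠ y} 1 ω := by
  classical
  by_cases h : ∃ t, 1 ≤ t ∧ X (s + t) ω = y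
  · have hle : returnTime X y s ω ≤ (Nat.find h : ℝ≥0∞) := 
      iInf₂_le (f := fun (t : ℕ) (_ : 1 ≤ t ∧ X (s + t) ω = y) => (t : ℝ≥0∞)) (Nat.find h)
        (Nat.find_spec h)
    refine hle.trans (le_trans ?_ (ENNReal.sum_le_tsum (Finset.range (Nat.find h))))
    rw [Finset.sum_congr rfl (g := fun _ => 1)]
    · simp
    · intro j hj
      refine Set.indicator_of_mem (fun i hij hX => ?_) _
      exact Nat.find_min h (lt_of_le_of_lt hij.2 (Finset.mem_range.1 hj)) ⟨hij.1, hX⟩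
  · have h1 : ∀ j : ℕ, Set.indicator {ω | ∀ i ∈ Set.Icc 1 j, X (s + i) ω ≠ y} 1 ω = (1 : ℝ≥0∞) :=
      fun j => Set.indicator_of_mem
        (s := {ω | ∀ i ∈ Set.Icc 1 j, X (s + i) ω ≠ y}) (fun i hij hX => h ⟨i, hij.1, hX⟩) _
    simp only [h1]
    rw [ENNReal.tsum_const_eq_top_of_ne_zero one_ne_zero]
    exact le_top

/-- Paths that do not visit `y` in the slots `1, …, j` after they start from `y`. -/
def avoidPaths (c y j : ℕ) : Set (ℕ → ℕ) := {n | ∀ i ∈ Set.Icc 1 j, lindley c n y i ≠ y}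

theorem measurableSet_avoidPaths (c y j : ℕ) : MeasurableSet (avoidPaths c y j) := by
  have h : avoidPaths c y j = ⋂ i, ⋂ (_ : i ∈ Set.Icc 1 j), {n | lindley c n y i = y}ᶜ := by
    ext n
    simp [avoidPaths]
  rw [h]
  exact MeasurableSet.iInter fun i => MeasurableSet.iInter fun _ =>
    (measurableSet_lindley_eq c y i y).compl

/-- Once the queue is at `y`, its future is the recursion from `y` driven by later arrivals, which
are independent of the past. -/
theorem measure_eq_and_avoid [IsProbabilityMeasure μ] (hm : ∀ t, Measurable (ξ t))
    (hi : iIndepFun ξ μ) (hd : ∀ t, μ.map (ξ t) = ν) (c s y j : ℕ) :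
    μ {ω | lindley c (fun j => ξ j ω) 0 s = y ∧
        ∀ i ∈ Set.Icc 1 j, lindley c (fun j => ξ j ω) 0 (s + i) ≠ y} =
      μ {ω | lindley c (fun j => ξ j ω) 0 s = y} * μ {ω | (fun j => ξ j ω) ∈ avoidPaths c y j} := by
  refine Eq.trans (congrArg μ (Set.ext fun ω => ?_))
    (measure_lindley_inter hm hi hd c s (A := {y}) (measurableSet_avoidPaths c y j))
  simp only [Set.mem_ofPred_eq, Set.mem_singleton_iff, avoidPaths]
  refine and_congr_right fun h => ?_
  simp only [lindley_add, h]

/-- Decomposition of the slots up to `T` by the last visit to `y`. -/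
theorem sum_measure_mul_avoid_le_one [IsProbabilityMeasure μ] (hm : ∀ t, Measurable (ξ t))
    (hi : iIndepFun ξ μ) (hd : ∀ t, μ.map (ξ t) = ν) (c y T : ℕ) :
    ∑ s ∈ Finset.range (T + 1), μ {ω | lindley c (fun j => ξ j ω) 0 s = y} *
      μ {ω | (fun j => ξ j ω) ∈ avoidPaths c y (T - s)} ≤ 1 := by
  have hmeas : Measurable fun ω j => ξ j ω := measurable_pi_lambda _ hm
  simp only [← measure_eq_and_avoid hm hi hd]
  rw [← measure_biUnion_finset]
  · exact prob_le_one
  · have key : ∀ s s' : ℕ, s < s' → s' ≤ T → Disjoint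
        {ω | lindley c (fun j => ξ j ω) 0 s = y ∧
          ∀ i ∈ Set.Icc 1 (T - s), lindley c (fun j => ξ j ω) 0 (s + i) ≠ y}
        {ω | lindley c (fun j => ξ j ω) 0 s' = y ∧
          ∀ i ∈ Set.Icc 1 (T - s'), lindley c (fun j => ξ j ω) 0 (s' + i) ≠ y} := by
      intro s s' hs hs'
      refine Set.disjoint_left.2 fun ω h1 h3 => ?_
      refine h1.2 (s' - s) ⟨by omega, by omega⟩ ?_
      rw [Nat.add_sub_cancel' hs.le]
      exact h3.1
    intro s hs s' hs' hne
    simp only [Finset.coe_range, Set.mem_Iio] at hs hs'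
    rcases lt_or_gt_of_ne hne with h | h
    · exact key s s' h (by omega)
    · exact (key s' s h (by omega)).symm
  · intro s _
    have h1 : {ω | lindley c (fun j => ξ j ω) 0 s = y ∧
        ∀ i ∈ Set.Icc 1 (T - s), lindley c (fun j => ξ j ω) 0 (s + i) ≠ y} =
        {ω | lindley c (fun j => ξ j ω) 0 s = y} ∩ ⋂ i, ⋂ (_ : i ∈ Set.Icc 1 (T - s)),
          {ω | lindley c (fun j => ξ j ω) 0 (s + i) = y}ᶜ := by
      ext ω
      simp
    rw [h1]
    exact (hmeas (measurableSet_lindley_eq c 0 s y)).inter (MeasurableSet.iInter fun i =>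
      MeasurableSet.iInter fun _ => (hmeas (measurableSet_lindley_eq c 0 (s + i) y)).compl)

/-- In the last-visit decomposition every visit probability from `s₀` on is at least `a`, so each
partial sum of avoidance probabilities is at most `1 / a`. -/
theorem tsum_avoid_ne_top [IsProbabilityMeasure μ] (hm : ∀ t, Measurable (ξ t))
    (hi : iIndepFun ξ μ) (hd : ∀ t, μ.map (ξ t) = ν) {c y s₀ : ℕ} {a : ℝ≥0∞} (ha : 0 < a)
    (h : ∀ s, s₀ ≤ s → a ≤ μ {ω | lindley c (fun j => ξ j ω) 0 s = y}) :
    ∑' j, μ {ω | (fun j => ξ j ω) ∈ avoidPaths c y j} ≠ ∞ := by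
  refine ne_top_of_le_ne_top (ENNReal.inv_ne_top.2 ha.ne') (ENNReal.tsum_le_of_sum_range_le
    fun J => ?_)
  rw [← one_div, ENNReal.le_div_iff_mul_le (Or.inl ha.ne')
    (Or.inl (ne_top_of_le_ne_top ENNReal.one_ne_top ((h s₀ le_rfl).trans prob_le_one)))]
  rcases Nat.eq_zero_or_pos J with rfl | hJ
  · simp
  -- With this horizon, the slots from `s₀` on use exactly the avoidance lengths `J - 1, …, 0`; the
  -- earlier slots are discarded.
  refine le_trans ?_ (sum_measure_mul_avoid_le_one hm hi hd c y (s₀ + (J - 1)))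
  rw [← Finset.sum_range_reflect (fun j => μ {ω | (fun j => ξ j ω) ∈ avoidPaths c y j}),
    mul_comm, Finset.mul_sum, show s₀ + (J - 1) + 1 = s₀ + J by omega, Finset.sum_range_add]
  refine le_trans (Finset.sum_le_sum fun j hj => ?_) le_add_self
  rw [show s₀ + (J - 1) - (s₀ + j) = J - 1 - j by omega]
  exact mul_le_mul_left (h _ (Nat.le_add_right _ _)) _

theorem isPositiveRecurrent_lindley [IsProbabilityMeasure μ] (hm : ∀ t, Measurable (ξ t))
    (hi : iIndepFun ξ μ) (hd : ∀ t, μ.map (ξ t) = ν) {c : ℕ} (hc : 0 < ν (Set.Iio c))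
    (hbdd : BoundedInProbability μ fun t ω => lindley c (fun j => ξ j ω) 0 t) :
    IsPositiveRecurrent μ fun t ω => lindley c (fun j => ξ j ω) 0 t := by
  have hpos := measure_forall_lt_pos hm hi hd hc
  -- To get from `x` to `y`: empty the queue in `x` slots, then follow the `s'`-slot path from `0`
  -- to `y`.
  refine ⟨isMarkovChain_lindley hm hi hd c, fun s s' x y hx hy => ⟨x + s', ?_⟩, fun s y => ?_⟩
  · exact (ENNReal.mul_pos hx.ne' (ENNReal.mul_pos (hpos x).ne' hy.ne').ne').trans_le
      (mul_le_measure_lindley_eq hm hi hd (A := {x}) (fun z hz => le_of_eq hz) s s' y)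
  have hXm := fun t => measurable_lindley_comp hm c 0 t
  have hset : ∀ t (A : Set ℕ), MeasurableSet {ω | lindley c (fun j => ξ j ω) 0 t ∈ A} :=
    fun t A => hXm t (.of_discrete (s := A))
  rcases eq_or_ne (μ {ω | lindley c (fun j => ξ j ω) 0 s = y}) 0 with h0 | h0
  · rw [Measure.restrict_eq_zero.2 h0, lintegral_zero_measure]
    exact ENNReal.zero_lt_top
  obtain ⟨C, hC⟩ := hbdd 2⁻¹ (by simp)
  have hlow : ∀ t, 2⁻¹ ≤ μ {ω | lindley c (fun j => ξ j ω) 0 t ∈ Set.Iic C} := by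
    intro t
    have h1 : {ω | lindley c (fun j => ξ j ω) 0 t ∈ Set.Iic C} =
        {ω | C < lindley c (fun j => ξ j ω) 0 t}ᶜ := by
      ext ω
      simp
    have h3 : MeasurableSet {ω | C < lindley c (fun j => ξ j ω) 0 t} := hset t (Set.Ioi C)
    rw [h1, prob_compl_eq_one_sub h3, ← ENNReal.one_sub_inv_two]
    exact tsub_le_tsub_left (hC t) 1
  -- Look back `C + s` slots: the queue is then at most `C` with probability at least one half,
  -- empties in `C` slots and reaches `y` in `s` more.
  have hvisit : ∀ t, C + s ≤ t → 2⁻¹ * (μ {ω | ∀ i < C, ξ i ω < c} *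
      μ {ω | lindley c (fun j => ξ j ω) 0 s = y}) ≤
      μ {ω | lindley c (fun j => ξ j ω) 0 t = y} := by
    intro t ht
    obtain ⟨r, rfl⟩ := Nat.exists_eq_add_of_le' ht
    exact (mul_le_mul_left (hlow r) _).trans ((mul_le_measure_lindley_eq hm hi hd
      (A := Set.Iic C) (fun z hz => hz) r s y).trans (measure_mono fun ω hω => hω.2))
  have hsum := tsum_avoid_ne_top hm hi hd
    (ENNReal.mul_pos (by simp) (ENNReal.mul_pos (hpos C).ne' h0).ne') hvisit
  have hev : ∀ j, MeasurableSet
      {ω | ∀ i ∈ Set.Icc 1 j, lindley c (fun j => ξ j ω) 0 (s + i) ≠ y} := by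
    intro j
    have h1 : {ω | ∀ i ∈ Set.Icc 1 j, lindley c (fun j => ξ j ω) 0 (s + i) ≠ y} =
        ⋂ i, ⋂ (_ : i ∈ Set.Icc 1 j), {ω | lindley c (fun j => ξ j ω) 0 (s + i) ∈ ({y}ᶜ : Set ℕ)} := by
      ext ω
      simp
    rw [h1]
    exact MeasurableSet.iInter fun i => MeasurableSet.iInter fun _ => hset _ _
  refine lt_of_le_of_lt (lintegral_mono fun ω => returnTime_le_tsum _ y s ω) ?_
  rw [lintegral_tsum fun j => (measurable_one.indicator (hev j)).aemeasurable]
  have hterm : ∀ j, ∫⁻ ω in {ω | lindley c (fun j => ξ j ω) 0 s = y},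
      Set.indicator {ω | ∀ i ∈ Set.Icc 1 j, lindley c (fun j => ξ j ω) 0 (s + i) ≠ y} 1 ω ∂μ ≤
      μ {ω | (fun j => ξ j ω) ∈ avoidPaths c y j} := by
    intro j
    rw [lintegral_indicator_one (hev j), Measure.restrict_apply (hev j), Set.inter_comm]
    refine (measure_eq_and_avoid hm hi hd c s y j).le.trans ?_
    exact mul_le_of_le_one_left' prob_le_one
  exact (ENNReal.tsum_le_tsum hterm).trans_lt hsum.lt_top

end Recurrence

end LLMServing

theorem theorem1 {m : ℕ} {Ω : Type*} [MeasurableSpace Ω] (μ : Measure Ω) [IsProbabilityMeasure μ]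
    -- prompt lengths, output lengths and activation budgets of the classes; KV cache capacity
    (l o b : Fin m → ℕ) (M : ℝ) (ho : ∀ k, 1 ≤ o k)
    -- `N t k` requests of class `k` arrive in slot `t`; for each `k` these numbers are i.i.d. in `t`
    (N : ℕ → Fin m → Ω → ℕ) (hN : ∀ t k, Measurable (N t k))
    (hindep : ∀ k, iIndepFun (fun t => N t k) μ)
    (P : Fin m → Measure ℕ) (hP : ∀ t k, μ.map (N t k) = P k)
    -- finite second moments, and means below the budgets
    (h2 : ∀ k, MemLp (fun n : ℕ => (n : ℝ)) 2 (P k))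
    (lam : Fin m → ℝ) (hlam : ∀ k, ∫ n : ℕ, (n : ℝ) ∂(P k) = lam k)
    (hb : ∀ k, lam k < b k)
    (hM : ∑ k, (b k : ℝ) * ((l k : ℝ) * o k + ((o k : ℝ) + (o k : ℝ) ^ 2) / 2) < M) :
    (∀ ω t k, LLMServing.numActivated l o b (fun s j => N s j ω) t k ≤ b k) ∧
    (∀ ω t, (LLMServing.kvUsage l o b (fun s j => N s j ω) t : ℝ) ≤ M) ∧
    LLMServing.IsStable μ l o b N := by

  have hq : ∀ k t, Measurable fun ω => LLMServing.queueLength l o b (fun s j => N s j ω) k t := by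
    intro k t
    simp only [LLMServing.queueLength_eq_lindley]
    exact LLMServing.measurable_lindley_comp (fun t => hN t k) (b k) 0 t
  have hmean : ∀ k, ∃ B : ℝ≥0∞, B ≠ ∞ ∧
      ∀ t, ∫⁻ ω, (LLMServing.queueLength l o b (fun s j => N s j ω) k t : ℝ≥0∞) ∂μ ≤ B := by
    intro k
    simp only [LLMServing.queueLength_eq_lindley]
    exact LLMServing.exists_lintegral_lindley_le (fun t => hN t k) (hindep k) (fun t => hP t k)
      (h2 k) ((hlam k).trans_lt (hb k))
  refine ⟨fun ω t k => LLMServing.length_activated_le l o b _ t _ k,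
    fun ω t => (LLMServing.kvUsage_le l o b _ t ho).trans hM.le, fun k => ?_, ?_⟩
  · obtain ⟨B, hB, hBt⟩ := hmean k
    have hbdd := LLMServing.boundedInProbability_of_lintegral_le (hq k) hB hBt
    simp only [LLMServing.queueLength_eq_lindley] at hbdd ⊢
    have hprob : IsProbabilityMeasure (P k) :=
      hP 0 k ▸ Measure.isProbabilityMeasure_map (hN 0 k).aemeasurable
    exact LLMServing.isPositiveRecurrent_lindley (fun t => hN t k) (hindep k) (fun t => hP t k)
      (LLMServing.measure_Iio_pos_of_integral_lt ((h2 k).integrable (by norm_num))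
        ((hlam k).trans_lt (hb k))) hbdd
  · choose B hB hBt using hmean
    -- The active set is bounded by a constant and the mean queue lengths add up, whatever the
    -- dependence between classes.
    have hsum : LLMServing.BoundedInProbability μ fun t ω =>
        (∑ k, LLMServing.queueLength l o b (fun s j => N s j ω) k t) +
          ∑ k, b k * (o k - 1) := by
      refine LLMServing.boundedInProbability_of_lintegral_le
        (B := (∑ k, B k) + (∑ k, b k * (o k - 1) : ℕ))
        (fun t => (Finset.measurable_fun_sum _ fun k _ => hq k t).add measurable_const)
        (ENNReal.add_ne_top.2 ⟨ENNReal.sum_ne_top.2 fun k _ => hB k, ENNReal.natCast_ne_top _⟩)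
        fun t => ?_
      have hcast : ∀ k, Measurable fun ω =>
          (LLMServing.queueLength l o b (fun s j => N s j ω) k t : ℝ≥0∞) := fun k =>
        Measurable.of_discrete.comp (hq k t)
      simp only [Nat.cast_add, Nat.cast_sum]
      rw [lintegral_add_right _ measurable_const, lintegral_finsetSum _ fun k _ => hcast k,
        lintegral_const, measure_univ, mul_one]
      gcongr with k
      exact hBt k t
    intro ε hε
    obtain ⟨C, hC⟩ := hsum ε hε
    refine ⟨C, fun t => (measure_mono fun ω hω => ?_).trans (hC t)⟩
    exact lt_of_lt_of_le hω
      (Nat.add_le_add_left (LLMServing.length_active_le l o b _ t ho) _)
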